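/- For $n\ge d\ge 0$, a $d$-dimensional subcube of $\{0,1\}^n$ is a set of the form $\{x\in\{0,1\}^n : x_i=c_i \text{ for all } i\in S\}$, where $S\subseteq\{1,\dots,n\}$ has exactly $n-d$ elements and $c_i\in\{0,1\}$ for $i\in S$; the density of $\mathcal F\subseteq\{0,1\}^n$ is $|\mathcal F|/2^n$. (i) There are sets $\mathcal F_n\subseteq\{0,1\}^n$ ($n=0,1,2,\dots$) such that, for every $n$, every 4-dimensional subcube of $\{0,1\}^n$ contains at most five points of $\mathcal F_n$, and $$\frac{|\mathcal F_n|}{2^n}=\frac13\prod_{k=1}^{\infty}\bigl(1-2^{-k}\bigr)-o(1)\qquad(n\to\infty),$$ where the infinite product converges and $\frac13\prod_{k\ge1}(1-2^{-k})\approx 0.0963$ (with error less than $0.0001$); here $o(1)$ denotes a quantity, of either sign, that tends to $0$. (ii) There is an absolute constant $c>0$ such that for every integer $d\ge5$ and every $n$ there is a set $\mathcal F\subseteq\{0,1\}^n$ of density at least $c/\sqrt d$ such that every $d$-dimensional subcube of $\{0,1\}^n$ contains fewer than $\binom{d}{\lfloor d/2\rfloor}$ points of $\mathcal F$. (iii)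 Consequently, for every integer $d\ge4$ the following statement (asked by Johnson and Talbot) is false: for every $\delta>0$ there is $n_0$ such that for all $n\ge n_0$, every subset of $\{0,1\}^n$ of density at least $\delta$ contains at least $\binom{d}{\lfloor d/2\rfloor}$ points of some $d$-dimensional subcube of $\{0,1\}^n$. -/

import Mathlib

open Filter Topology

/-- The discrete cube `{0,1}^n`. -/
abbrev Cube (n : ℕ) : Type := Fin n → Bool

/-- `V` is a `d`-dimensional subcube of `{0,1}^n`: for some set `S` of exactly `n - d` coordinates
(so `d ≤ n`) and some prescribed values `c i` for `i ∈ S`, it consists of all points that take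
these values on `S`. The values of `c` outside `S` play no role. -/
def IsSubcube {n : ℕ} (d : ℕ) (V : Finset (Cube n)) : Prop :=
  ∃ (S : Finset (Fin n)) (c : Cube n), S.card + d = n ∧
    V = Finset.univ.filter (fun x : Cube n => ∀ i ∈ S, x i = c i)

/-- The density `|F| / 2^n` of a set `F ⊆ {0,1}^n`. -/
noncomputable def density {n : ℕ} (F : Finset (Cube n)) : ℝ :=
  (F.card : ℝ) / 2 ^ n

/-- The affirmative answer, for a given `d`, to the question of Johnson and Talbot: for every
`δ > 0` and all sufficiently large `n`, every subset of `{0,1}^n` of density at least `δ` contains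
at least `d.choose (d / 2)` points of some `d`-dimensional subcube. -/
def JohnsonTalbotProperty (d : ℕ) : Prop :=
  ∀ δ : ℝ, 0 < δ → ∃ n₀ : ℕ, ∀ n : ℕ, n₀ ≤ n → ∀ F : Finset (Cube n), δ ≤ density F →
    ∃ V : Finset (Cube n), IsSubcube d V ∧ d.choose (d / 2) ≤ (F ∩ V).card

/-- The `k`-th factor, `1 - 2^{-k}`, `k ≥ 1`, of the infinite product, with `k` shifted by one. -/
noncomputable def factor (k : ℕ) : ℝ := 1 - (1 / 2 : ℝ) ^ (k + 1)

/-! For each weight `w`, attach a vector of `𝔽₂ʷ` to every coordinate, and keep a point of weight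
`w` when its ones index a basis. Random vectors form a basis with probability `∏_{k ≤ w} (1 - 2⁻ᵏ)`,
so some choice keeps at least a proportion `P = ∏' k, factor k` of every weight level. Keeping only
the best class of weights modulo `m` leaves density at least `P / m`.

In a subcube, fix all but two of the ones. If independent, they span a subspace with quotient `𝔽₂²`,
which has only three nonzero vectors; hence among four further coordinates some pair does not
complete a basis (`exists_pair_not_linearIndepOn`). Averaging shows that at most `5/6` of each level
`2 ≤ t ≤ d - 2` survives (`six_mul_card_le_of_forall_exists_pair`). For `d = 4`, `m = 3` this gives
five points. For `d ≥ 5`, take `m` of order `√d`: the binomial coefficients in one class modulo `m`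
sum to at most `11/10` of the middle one (`mul_sum_choose_le`), and `5/6 · 11/10 < 1` leaves room
for the outermost levels. -/

/-! ### The infinite product. -/

theorem factor_pos (k : ℕ) : 0 < factor k := by
  have : (1 / 2 : ℝ) ^ (k + 1) < 1 := pow_lt_one₀ (by norm_num) (by norm_num) (by omega)
  unfold factor; linarith

theorem factor_lt_one (k : ℕ) : factor k < 1 := by
  have : (0 : ℝ) < (1 / 2 : ℝ) ^ (k + 1) := by positivity
  unfold factor; linarith

theorem multipliable_factor : Multipliable factor := by
  have h : Summable fun k : ℕ => -(1 / 2 : ℝ) ^ (k + 1) :=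
    ((summable_nat_add_iff 1).2 summable_geometric_two).neg
  have := Real.multipliable_one_add_of_summable h
  refine this.congr fun k => ?_
  unfold factor; ring

theorem antitone_prod_factor : Antitone fun n : ℕ => ∏ k ∈ Finset.range n, factor k := by
  refine antitone_nat_of_succ_le fun n => ?_
  rw [Finset.prod_range_succ]
  exact mul_le_of_le_one_right (Finset.prod_nonneg fun k _ => (factor_pos k).le) (factor_lt_one n).le

theorem tendsto_prod_factor :
    Tendsto (fun n : ℕ => ∏ k ∈ Finset.range n, factor k) atTop (𝓝 (∏' k : ℕ, factor k)) :=
  multipliable_factor.hasProd.tendsto_prod_nat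

theorem tprod_factor_le_prod (n : ℕ) :
    ∏' k : ℕ, factor k ≤ ∏ k ∈ Finset.range n, factor k :=
  antitone_prod_factor.le_of_tendsto tendsto_prod_factor n

/-- Weierstrass' product inequality for the factors beyond the first `N`. -/
theorem prod_factor_mul_le (N n : ℕ) :
    (∏ k ∈ Finset.range N, factor k) * (1 - (1 / 2 : ℝ) ^ N + (1 / 2 : ℝ) ^ (N + n)) ≤
      ∏ k ∈ Finset.range (N + n), factor k := by
  induction n with
  | zero => simp
  | succ n ih =>
    rw [← Nat.add_assoc, Finset.prod_range_succ]
    have h := mul_le_mul_of_nonneg_right ih (factor_pos (N + n)).le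
    refine le_trans ?_ h
    rw [mul_assoc]
    refine mul_le_mul_of_nonneg_left ?_ (Finset.prod_nonneg fun k _ => (factor_pos k).le)
    unfold factor
    have h1 : (1 / 2 : ℝ) ^ (N + n) ≤ (1 / 2 : ℝ) ^ N :=
      pow_le_pow_of_le_one (by norm_num) (by norm_num) (by omega)
    have h0 : (0 : ℝ) < (1 / 2 : ℝ) ^ (N + n) := by positivity
    rw [pow_succ]
    nlinarith

theorem prod_factor_mul_le_tprod (N : ℕ) :
    (∏ k ∈ Finset.range N, factor k) * (1 - (1 / 2 : ℝ) ^ N) ≤ ∏' k : ℕ, factor k := by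
  refine ge_of_tendsto tendsto_prod_factor ?_
  filter_upwards [eventually_ge_atTop N] with n hn
  obtain ⟨m, rfl⟩ := Nat.exists_eq_add_of_le hn
  refine le_trans ?_ (prod_factor_mul_le N m)
  refine mul_le_mul_of_nonneg_left ?_ (Finset.prod_nonneg fun k _ => (factor_pos k).le)
  have : (0 : ℝ) < (1 / 2 : ℝ) ^ (N + m) := by positivity
  linarith

theorem abs_tprod_factor_sub_lt :
    |(1 / 3 : ℝ) * (∏' k : ℕ, factor k) - 0.0963| < 0.0001 := by
  -- Thirteen factors enclose the product up to a relative error `2⁻¹³`, which is precise enough.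
  have h1 := tprod_factor_le_prod 13
  have h2 := prod_factor_mul_le_tprod 13
  generalize ∏' k : ℕ, factor k = P at h1 h2 ⊢
  simp only [Finset.prod_range_succ, Finset.prod_range_zero, factor] at h1 h2
  norm_num at h1 h2
  rw [abs_lt]
  constructor <;> norm_num <;> linarith

theorem tprod_factor_pos : 0 < ∏' k : ℕ, factor k := by
  have h := abs_lt.1 abs_tprod_factor_sub_lt
  norm_num at h
  linarith [h.1]

/-! ### Averaging over permutations. -/

/-- Over all permutations, the images of a fixed `t`-set are equidistributed among the `t`-sets. -/
theorem choose_mul_card_perm_filter {α : Type*} [Fintype α] [DecidableEq α] (p : Finset α → Prop)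
    [DecidablePred p] (X₀ : Finset α) :
    (Fintype.card α).choose X₀.card *
        (Finset.univ.filter fun σ : Equiv.Perm α => p (X₀.map σ.toEmbedding)).card =
      (Fintype.card α).factorial *
        ((Finset.powersetCard X₀.card Finset.univ).filter p).card := by
  have key : ∀ X ∈ Finset.powersetCard X₀.card (Finset.univ : Finset α),
      (Finset.univ.filter fun σ : Equiv.Perm α => p (X.map σ.toEmbedding)).card =
      (Finset.univ.filter fun σ : Equiv.Perm α => p (X₀.map σ.toEmbedding)).card := by
    intro X hX
    have hc : X.card = X₀.card := (Finset.mem_powersetCard.1 hX).2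
    obtain ⟨τ, hτ⟩ : ∃ τ : Equiv.Perm α, X₀.map τ.toEmbedding = X := by
      let e : {a // a ∈ X₀} ≃ {a // a ∈ X} := Finset.equivOfCardEq hc.symm
      refine ⟨e.extendSubtype, ?_⟩
      refine Finset.eq_of_subset_of_card_le ?_ (by simp [hc])
      intro y hy
      obtain ⟨x, hx, rfl⟩ := Finset.mem_map.1 hy
      exact e.extendSubtype_mem x hx
    refine Finset.card_bij (fun σ _ => σ * τ) ?_ ?_ ?_
    · intro σ hσ
      simp only [Finset.mem_filter, Finset.mem_univ, true_and] at hσ ⊢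
      rw [← hτ, Finset.map_map] at hσ
      exact hσ
    · intro σ _ σ' _ h
      exact mul_right_cancel h
    · intro σ hσ
      refine ⟨σ * τ⁻¹, ?_, by simp⟩
      simp only [Finset.mem_filter, Finset.mem_univ, true_and] at hσ ⊢
      rw [← hτ, Finset.map_map]
      convert hσ using 2
      ext x
      simp
  -- The pairs `(X, σ)` with `p (σ X)` are counted in both orders.
  have h1 : ∑ X ∈ Finset.powersetCard X₀.card (Finset.univ : Finset α),
      (Finset.univ.filter fun σ : Equiv.Perm α => p (X.map σ.toEmbedding)).card =
      (Fintype.card α).choose X₀.card *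
        (Finset.univ.filter fun σ : Equiv.Perm α => p (X₀.map σ.toEmbedding)).card := by
    rw [Finset.sum_congr rfl key]
    simp [Finset.card_powersetCard]
  rw [← h1]
  simp only [Finset.card_filter]
  rw [Finset.sum_comm]
  have h2 : ∀ σ : Equiv.Perm α,
      ∑ X ∈ Finset.powersetCard X₀.card (Finset.univ : Finset α),
        (if p (X.map σ.toEmbedding) then 1 else 0) =
      ∑ X ∈ Finset.powersetCard X₀.card (Finset.univ : Finset α), if p X then 1 else 0 := by
    intro σ
    refine Finset.sum_nbij (fun X => X.map σ.toEmbedding) ?_ ?_ ?_ ?_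
    · intro X hX; simpa using hX
    · intro X _ Y _ h; exact Finset.map_injective _ h
    · intro Y hY
      refine ⟨Y.map σ⁻¹.toEmbedding, by simpa using hY, ?_⟩
      simp only [Finset.map_map]
      convert Finset.map_refl
      ext x
      simp
    · intro X _; rfl
  rw [Finset.sum_congr rfl fun σ _ => h2 σ]
  simp [Finset.card_univ, Fintype.card_perm]

/-- If among any `t + 2` elements, split into a `(t - 2)`-set `Y` and a `4`-set `Z`, one of the six
sets `Y ∪ q` with `q` a pair in `Z` fails `p`, then `p` holds for at most `5 / 6` of the
`t`-sets. -/
theorem six_mul_card_le_of_forall_exists_pair {α : Type*} [Fintype α] [DecidableEq α]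
    (p : Finset α → Prop) [DecidablePred p] {t : ℕ} (ht : 2 ≤ t) (htc : t + 2 ≤ Fintype.card α)
    (h : ∀ Y Z : Finset α, Y.card + 2 = t → Z.card = 4 → Disjoint Y Z →
      ∃ q ∈ Finset.powersetCard 2 Z, ¬ p (Y ∪ q)) :
    6 * ((Finset.powersetCard t Finset.univ).filter p).card ≤ 5 * (Fintype.card α).choose t := by
  obtain ⟨U, -, hU⟩ := Finset.exists_subset_card_eq (s := (Finset.univ : Finset α)) (n := t + 2)
    (by simpa using htc)
  obtain ⟨Y, hYU, hY⟩ := Finset.exists_subset_card_eq (s := U) (n := t - 2) (by omega)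
  set Z := U \ Y with hZdef
  have hZ : Z.card = 4 := by rw [hZdef, Finset.card_sdiff_of_subset hYU]; omega
  have hYZ : Disjoint Y Z := Finset.disjoint_sdiff
  have hcard : ∀ q ∈ Finset.powersetCard 2 Z, (Y ∪ q).card = t := by
    intro q hq
    obtain ⟨hqZ, hq2⟩ := Finset.mem_powersetCard.1 hq
    rw [Finset.card_union_of_disjoint (hYZ.mono_right hqZ)]
    omega
  have hP : (Finset.powersetCard 2 Z).card = 6 := by
    rw [Finset.card_powersetCard, hZ]; rfl
  -- Each permutation carries `Y`, `Z` to another such split, so at most five of the six images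
  -- satisfy `p`.
  have hle : ∑ q ∈ Finset.powersetCard 2 Z,
      (Finset.univ.filter fun σ : Equiv.Perm α => p ((Y ∪ q).map σ.toEmbedding)).card ≤
      5 * (Fintype.card α).factorial := by
    simp only [Finset.card_filter]
    rw [Finset.sum_comm]
    have : ∀ σ ∈ (Finset.univ : Finset (Equiv.Perm α)), ∑ q ∈ Finset.powersetCard 2 Z,
        (if p ((Y ∪ q).map σ.toEmbedding) then 1 else 0) ≤ 5 := by
      intro σ _
      rw [← Finset.card_filter]
      obtain ⟨q, hq, hqp⟩ := h (Y.map σ.toEmbedding) (Z.map σ.toEmbedding)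
        (by rw [Finset.card_map]; omega) (by rw [Finset.card_map]; exact hZ)
        ((Finset.disjoint_map _).2 hYZ)
      obtain ⟨hqZ, hq2⟩ := Finset.mem_powersetCard.1 hq
      obtain ⟨q', hq'Z, rfl⟩ := Finset.subset_map_iff.1 hqZ
      have hlt : ((Finset.powersetCard 2 Z).filter
          fun q => p ((Y ∪ q).map σ.toEmbedding)).card < (Finset.powersetCard 2 Z).card := by
        refine Finset.card_lt_card (Finset.filter_ssubset.2 ⟨q', ?_, ?_⟩)
        · rw [Finset.card_map] at hq2
          exact Finset.mem_powersetCard.2 ⟨hq'Z, hq2⟩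
        · rwa [Finset.map_union]
      omega
    refine (Finset.sum_le_sum this).trans ?_
    simp [Finset.card_univ, Fintype.card_perm, mul_comm]
  have hsum : ∑ q ∈ Finset.powersetCard 2 Z, (Fintype.card α).choose t *
      (Finset.univ.filter fun σ : Equiv.Perm α => p ((Y ∪ q).map σ.toEmbedding)).card =
      6 * ((Fintype.card α).factorial * ((Finset.powersetCard t Finset.univ).filter p).card) := by
    rw [← hP, ← smul_eq_mul, ← Finset.sum_const]
    refine Finset.sum_congr rfl fun q hq => ?_
    have := choose_mul_card_perm_filter p (Y ∪ q)
    rwa [hcard q hq] at this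
  rw [← Finset.mul_sum] at hsum
  have := Nat.mul_le_mul_left ((Fintype.card α).choose t) hle
  rw [hsum] at this
  refine le_of_mul_le_mul_left (a := (Fintype.card α).factorial) ?_ (Nat.factorial_pos _)
  linarith

/-! ### Linear independence over `𝔽₂`. -/

/-- Four vectors in a two-dimensional quotient of a space over `𝔽₂` are not pairwise linearly
independent. -/
theorem exists_pair_not_linearIndepOn {ι V : Type*} [DecidableEq ι] [AddCommGroup V]
    [Module (ZMod 2) V] [FiniteDimensional (ZMod 2) V] (v : ι → V) (C Z : Finset ι)
    (hC : C.card + 2 = Module.finrank (ZMod 2) V) (hZ : Z.card = 4) (hCZ : Disjoint C Z) :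
    ∃ q ∈ Finset.powersetCard 2 Z, ¬ LinearIndepOn (ZMod 2) v (↑(C ∪ q) : Set ι) := by
  by_contra! hall
  have hpair : ∀ x ∈ Z, ∀ y ∈ Z, x ≠ y →
      v x ∉ Submodule.span (ZMod 2) (v '' (insert y (C : Set ι))) := by
    intro x hx y hy hxy
    have hli := hall {x, y} (Finset.mem_powersetCard.2
      ⟨by simp [Finset.insert_subset_iff, hx, hy], Finset.card_pair hxy⟩)
    have hset : (↑(C ∪ {x, y}) : Set ι) = insert x (insert y (C : Set ι)) := by
      ext z; simp
    rw [hset] at hli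
    have hxn : x ∉ insert y (C : Set ι) := by
      rintro (h | h)
      · exact hxy h
      · exact Finset.disjoint_left.1 hCZ h hx
    exact ((linearIndepOn_insert hxn).1 hli).2
  have hexists : ∀ x ∈ Z, ∃ y ∈ Z, x ≠ y := by
    intro x hx
    obtain ⟨y, hy, hyx⟩ := Finset.exists_mem_ne (by omega : 1 < Z.card) x
    exact ⟨y, hy, hyx.symm⟩
  have hCli : LinearIndepOn (ZMod 2) v (C : Set ι) := by
    obtain ⟨q, hq, hq2⟩ := Finset.exists_subset_card_eq (s := Z) (n := 2) (by omega)
    refine (hall q (Finset.mem_powersetCard.2 ⟨hq, hq2⟩)).mono ?_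
    simp
  set W := Submodule.span (ZMod 2) (v '' (C : Set ι)) with hW
  have hWrank : Module.finrank (ZMod 2) W = C.card := by
    have h := finrank_span_eq_card hCli.linearIndependent
    rw [show Set.range (fun i : (C : Set ι) => v i) = v '' (C : Set ι) by
      rw [Set.image_eq_range]] at h
    simpa using h
  have hQ : Module.finrank (ZMod 2) (V ⧸ W) = 2 := by
    have := Submodule.finrank_quotient_add_finrank W
    omega
  have : Finite (V ⧸ W) := Module.finite_of_finite (ZMod 2)
  have : Fintype (V ⧸ W) := Fintype.ofFinite _
  have hcard : Fintype.card (V ⧸ W) = 4 := by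
    rw [Module.card_eq_pow_finrank (K := ZMod 2), hQ, ZMod.card]; rfl
  classical
  -- By `hpair` the classes of the four vectors modulo `W` are nonzero and distinct, but only three
  -- nonzero classes exist.
  have hle : Z.card ≤ (Finset.univ.erase (0 : V ⧸ W)).card := by
    refine Finset.card_le_card_of_injOn (fun x => W.mkQ (v x)) ?_ ?_
    · intro x hx
      obtain ⟨y, hy, hxy⟩ := hexists x hx
      simp only [Finset.coe_erase, Finset.coe_univ, Set.mem_sdiff, Set.mem_univ, true_and,
        Set.mem_singleton_iff, Submodule.mkQ_apply, Submodule.Quotient.mk_eq_zero]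
      intro h
      exact hpair x hx y hy hxy
        (Submodule.span_mono (Set.image_mono (Set.subset_insert _ _)) h)
    · intro x hx y hy h
      by_contra hxy
      refine hpair x hx y hy hxy ?_
      have hsub : v x - v y ∈ W := (Submodule.Quotient.eq W).1 h
      have h1 : v x - v y ∈ Submodule.span (ZMod 2) (v '' (insert y (C : Set ι))) :=
        Submodule.span_mono (Set.image_mono (Set.subset_insert _ _)) hsub
      have h2 : v y ∈ Submodule.span (ZMod 2) (v '' (insert y (C : Set ι))) :=
        Submodule.subset_span ⟨y, Set.mem_insert _ _, rfl⟩
      simpa using Submodule.add_mem _ h1 h2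
  rw [Finset.card_erase_of_mem (Finset.mem_univ _), Finset.card_univ, hcard, hZ] at hle
  omega

/-- The count of ordered bases is `∏ i < w, (2ʷ - 2ⁱ)`; with `i = w - 1 - k` each term is `2ʷ *
factor k`. -/
theorem card_linearIndependent_zmod_two (w : ℕ) :
    (Nat.card {s : Fin w → Fin w → ZMod 2 // LinearIndependent (ZMod 2) s} : ℝ) =
      (∏ k ∈ Finset.range w, factor k) * 2 ^ (w * w) := by
  have h := card_linearIndependent (K := ZMod 2) (V := Fin w → ZMod 2) (k := w) (by simp)
  rw [h]
  simp only [ZMod.card, Module.finrank_fin_fun]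
  rw [Fin.prod_univ_eq_prod_range (fun i => 2 ^ w - 2 ^ i), Nat.cast_prod,
    ← Finset.prod_range_reflect, pow_mul]
  conv_rhs => rw [← Finset.card_range w, ← Finset.prod_const, Finset.card_range,
    ← Finset.prod_mul_distrib]
  refine Finset.prod_congr rfl fun k hk => ?_
  have hk' : k < w := Finset.mem_range.1 hk
  rw [Nat.cast_sub (Nat.pow_le_pow_right (by norm_num) (by omega))]
  push_cast
  unfold factor
  have : (2 : ℝ) ^ w = 2 ^ (w - 1 - k) * 2 ^ (k + 1) := by rw [← pow_add]; congr 1; omega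
  rw [this, one_div, inv_pow]
  field_simp

/-- For a set `A` of `w` indices, the number of assignments of vectors in `𝔽₂ʷ` to all indices that
are linearly independent on `A`. -/
theorem card_linearIndepOn_zmod_two {n w : ℕ} (A : Finset (Fin n)) (hA : A.card = w) :
    (Nat.card {v : Fin n → Fin w → ZMod 2 // LinearIndepOn (ZMod 2) v (A : Set (Fin n))} : ℝ) =
      (∏ k ∈ Finset.range w, factor k) *
        Nat.card (Fin n → Fin w → ZMod 2) := by
  let e := Equiv.piEquivPiSubtypeProd (fun i : Fin n => i ∈ A) (fun _ => Fin w → ZMod 2)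
  let g : Fin w ≃ {i // i ∈ A} := (Finset.equivFinOfCardEq hA).symm
  have h1 : Nat.card {v : Fin n → Fin w → ZMod 2 // LinearIndepOn (ZMod 2) v (A : Set (Fin n))} =
      Nat.card ({s : Fin w → Fin w → ZMod 2 // LinearIndependent (ZMod 2) s} ×
        ({i // i ∉ A} → Fin w → ZMod 2)) := by
    refine Nat.card_congr ?_
    refine (e.subtypeEquiv (q := fun y => LinearIndependent (ZMod 2) y.1) fun v => Iff.rfl).trans ?_
    refine (Equiv.prodSubtypeFstEquivSubtypeProd
      (p := fun y : {i // i ∈ A} → Fin w → ZMod 2 => LinearIndependent (ZMod 2) y)).trans ?_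
    refine Equiv.prodCongr ?_ (Equiv.refl _)
    refine (g.symm.arrowCongr (Equiv.refl _)).subtypeEquiv fun v => ?_
    exact (linearIndependent_equiv g).symm
  have h2 : Nat.card {i // i ∉ A} = n - w := by
    rw [Nat.card_eq_fintype_card, Fintype.card_subtype_compl]; simp [hA]
  have hwn : w ≤ n := by rw [← hA]; simpa using A.card_le_univ
  rw [h1, Nat.card_prod, Nat.cast_mul, card_linearIndependent_zmod_two, mul_assoc]
  congr 1
  have h3 : Nat.card (Fin w → ZMod 2) = 2 ^ w := by simp
  rw [Nat.card_fun, Nat.card_fun (α := Fin n), h2, h3, Nat.card_fin]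
  push_cast
  rw [← pow_mul, ← pow_mul, ← pow_add, ← Nat.mul_add, Nat.add_sub_cancel' hwn]

open Classical in
-- First moment method: some assignment `v` reaches the average over all assignments.
theorem exists_card_linearIndepOn_ge (n w : ℕ) :
    ∃ v : Fin n → Fin w → ZMod 2, (n.choose w : ℝ) * ∏' k : ℕ, factor k ≤
      ((Finset.powersetCard w Finset.univ).filter
        fun A : Finset (Fin n) => LinearIndepOn (ZMod 2) v (A : Set (Fin n))).card := by
  have hsum : ∑ _v : Fin n → Fin w → ZMod 2,
      (n.choose w : ℝ) * ∏ k ∈ Finset.range w, factor k =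
      ∑ v : Fin n → Fin w → ZMod 2, (((Finset.powersetCard w Finset.univ).filter
        fun A : Finset (Fin n) => LinearIndepOn (ZMod 2) v (A : Set (Fin n))).card : ℝ) := by
    simp only [Finset.card_filter, Nat.cast_sum]
    rw [Finset.sum_comm]
    have : ∀ A ∈ Finset.powersetCard w (Finset.univ : Finset (Fin n)),
        ∑ v : Fin n → Fin w → ZMod 2,
          ((if LinearIndepOn (ZMod 2) v (A : Set (Fin n)) then 1 else 0 : ℕ) : ℝ) =
        (∏ k ∈ Finset.range w, factor k) * Nat.card (Fin n → Fin w → ZMod 2) := by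
      intro A hA
      rw [← card_linearIndepOn_zmod_two A (Finset.mem_powersetCard.1 hA).2, ← Nat.cast_sum,
        ← Finset.card_filter, Nat.card_eq_fintype_card, Fintype.card_subtype]
    rw [Finset.sum_congr rfl this]
    simp only [Finset.sum_const, Finset.card_powersetCard, Finset.card_univ, Fintype.card_fin,
      nsmul_eq_mul, Nat.card_eq_fintype_card]
    ring
  obtain ⟨v, -, hv⟩ := Finset.exists_le_of_sum_le Finset.univ_nonempty hsum.le
  exact ⟨v, (mul_le_mul_of_nonneg_left (tprod_factor_le_prod w) (by positivity)).trans hv⟩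

/-! ### Estimates for binomial coefficients. -/

/-- From `k` to `k + 1` the right side grows by the factor `4 (2k + 1)² / (k (k + 1))`, which is at
least `16`. -/
theorem sixteen_pow_le (k : ℕ) (hk : 1 ≤ k) : 16 ^ k ≤ 4 * k * k.centralBinom ^ 2 := by
  induction k, hk using Nat.le_induction with
  | base => decide
  | succ k hk ih =>
    have h := Nat.succ_mul_centralBinom_succ k
    set a := k.centralBinom
    set b := (k + 1).centralBinom
    have h2 : (k + 1) * (4 * (k + 1) * b ^ 2) = 4 * (2 * (2 * k + 1) * a) ^ 2 := by
      rw [← h]; ring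
    refine le_of_mul_le_mul_left (a := k + 1) ?_ (by omega)
    rw [h2, pow_succ]
    have : (k + 1) * (16 ^ k * 16) ≤ (k + 1) * ((4 * k * a ^ 2) * 16) := by gcongr
    refine this.trans ?_
    nlinarith [Nat.zero_le (a ^ 2)]

theorem two_pow_sq_le (d : ℕ) (hd : 1 ≤ d) :
    (2 ^ d) ^ 2 ≤ 2 * (d + 1) * d.choose (d / 2) ^ 2 := by
  rcases Nat.even_or_odd' d with ⟨k, rfl | rfl⟩
  · have h := sixteen_pow_le k (by omega)
    rw [Nat.centralBinom_eq_two_mul_choose] at h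
    rw [Nat.mul_div_cancel_left _ (by norm_num), ← pow_mul, mul_right_comm, pow_mul]
    norm_num
    nlinarith [Nat.zero_le ((2 * k).choose k ^ 2)]
  · have h := sixteen_pow_le (k + 1) (by omega)
    have hb : (k + 1).centralBinom = 2 * (2 * k + 1).choose k := by
      rw [Nat.centralBinom_eq_two_mul_choose, show 2 * (k + 1) = 2 * k + 1 + 1 by ring,
        Nat.choose_succ_succ, Nat.choose_symm_half]
      ring
    rw [hb] at h
    rw [show (2 * k + 1) / 2 = k by omega]
    have h4 : 4 * (2 ^ (2 * k + 1)) ^ 2 = 16 ^ (k + 1) := by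
      rw [← pow_mul, show (4 : ℕ) = 2 ^ 2 by norm_num, show (16 : ℕ) = 2 ^ 4 by norm_num,
        ← pow_mul, ← pow_add]
      congr 1; ring
    nlinarith

theorem two_pow_le_sqrt_mul_choose (d : ℕ) (hd : 1 ≤ d) :
    2 ^ d ≤ 2 * (Nat.sqrt d + 1) * d.choose (d / 2) := by
  have h := two_pow_sq_le d hd
  have hs : d + 1 ≤ (Nat.sqrt d + 1) ^ 2 := Nat.succ_le_succ_sqrt' d
  refine (Nat.pow_le_pow_iff_left (n := 2) (by norm_num)).1 ?_
  refine h.trans ?_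
  rw [mul_pow]
  refine Nat.mul_le_mul_right _ ?_
  nlinarith

theorem choose_le_choose_of_le_half {d i j : ℕ} (hij : i ≤ j) (hj : j ≤ d / 2) :
    d.choose i ≤ d.choose j := by
  induction j, hij using Nat.le_induction with
  | base => exact le_rfl
  | succ j hij ih => exact (ih (by omega)).trans (Nat.choose_le_succ_of_lt_half_left (by omega))

theorem choose_le_choose_of_half_le {d i j : ℕ} (hij : i ≤ j) (hi : d / 2 ≤ i) :
    d.choose j ≤ d.choose i := by
  induction j, hij using Nat.le_induction with
  | base => exact le_rfl
  | succ j hij ih =>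
    refine le_trans ?_ ih
    have h := Nat.choose_succ_right_eq d j
    refine le_of_mul_le_mul_right (a := j + 1) ?_ (by omega)
    rw [h]
    exact Nat.mul_le_mul_left _ (by omega)

/-- Binomial coefficients at indices in a fixed class modulo `2 * h` add up to at most the middle
one plus `2 ^ d / h`. -/
theorem mul_sum_choose_le {d h a : ℕ} (D : Finset ℕ) (hDd : ∀ t ∈ D, t ≤ d)
    (hD : ∀ t ∈ D, t % (2 * h) = a) :
    h * ∑ t ∈ D, d.choose t ≤ h * d.choose (d / 2) + 2 ^ d := by
  have heq : ∀ t ∈ D, ∀ t' ∈ D, t < t' + 2 * h → t' < t + 2 * h → t = t' := by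
    intro t ht t' ht' h1 h2
    have hm : t ≡ t' [MOD 2 * h] := (hD t ht).trans (hD t' ht').symm
    rcases le_total t t' with hle | hle
    · have := (Nat.modEq_iff_dvd' hle).1 hm
      have := Nat.eq_zero_of_dvd_of_lt this (by omega)
      omega
    · have := (Nat.modEq_iff_dvd' hle).1 hm.symm
      have := Nat.eq_zero_of_dvd_of_lt this (by omega)
      omega
  -- Distinct elements of `D` differ by at least `2 * h`, so at most one lies within distance less
  -- than `h` of the middle.
  let near : ℕ → Prop := fun t => d / 2 < t + h ∧ t < d / 2 + h
  have hnear : ∑ t ∈ D.filter near, d.choose t ≤ d.choose (d / 2) := by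
    have hc : (D.filter near).card ≤ 1 := by
      refine Finset.card_le_one.2 fun t ht t' ht' => ?_
      obtain ⟨ht, h1, h2⟩ := Finset.mem_filter.1 ht
      obtain ⟨ht', h3, h4⟩ := Finset.mem_filter.1 ht'
      exact heq t ht t' ht' (by omega) (by omega)
    calc ∑ t ∈ D.filter near, d.choose t
        ≤ (D.filter near).card • d.choose (d / 2) :=
          Finset.sum_le_card_nsmul _ _ _ fun t _ => Nat.choose_le_middle t d
      _ ≤ d.choose (d / 2) := by
          rw [smul_eq_mul]; exact (Nat.mul_le_mul_right _ hc).trans (by simp)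
  have hfar : h * ∑ t ∈ D.filter (fun t => ¬ near t), d.choose t ≤ 2 ^ d := by
    -- Each far `t` is charged to the `h` indices starting at `t` and moving towards the middle.
    -- Their coefficients are no smaller, and the blocks are disjoint, so the total is at most `2 ^
    -- d`.
    let φ : ℕ × ℕ → ℕ := fun x => if x.1 < d / 2 then x.1 + x.2 else x.1 - x.2
    set E := D.filter (fun t => ¬ near t) with hE
    have hEm : ∀ t ∈ E, t ∈ D ∧ (t + h ≤ d / 2 ∨ d / 2 + h ≤ t) := by
      intro t ht
      obtain ⟨h1, h2⟩ := Finset.mem_filter.1 ht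
      refine ⟨h1, ?_⟩
      by_contra hcon
      exact h2 ⟨by omega, by omega⟩
    have hinj : Set.InjOn φ (E ×ˢ Finset.range h : Finset (ℕ × ℕ)) := by
      rintro ⟨t, i⟩ hx ⟨t', i'⟩ hy hφ
      obtain ⟨ht, hi⟩ := Finset.mem_product.1 (Finset.mem_coe.1 hx)
      obtain ⟨ht', hi'⟩ := Finset.mem_product.1 (Finset.mem_coe.1 hy)
      obtain ⟨hD1, hf1⟩ := hEm t ht
      obtain ⟨hD2, hf2⟩ := hEm t' ht'
      simp only [Finset.mem_range] at hi hi'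
      simp only [φ] at hφ
      have htt : t = t' := by
        refine heq t hD1 t' hD2 ?_ ?_ <;> split_ifs at hφ <;> omega
      subst htt
      have : i = i' := by split_ifs at hφ <;> omega
      rw [this]
    calc h * ∑ t ∈ E, d.choose t = ∑ x ∈ E ×ˢ Finset.range h, d.choose x.1 := by
          rw [Finset.sum_product, Finset.mul_sum]
          simp
      _ ≤ ∑ x ∈ E ×ˢ Finset.range h, d.choose (φ x) := by
          refine Finset.sum_le_sum fun x hx => ?_
          obtain ⟨ht, hi⟩ := Finset.mem_product.1 hx
          obtain ⟨-, hf⟩ := hEm x.1 ht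
          simp only [Finset.mem_range] at hi
          simp only [φ]
          split_ifs with hlt
          · exact choose_le_choose_of_le_half (by omega) (by omega)
          · exact choose_le_choose_of_half_le (by omega) (by omega)
      _ = ∑ j ∈ (E ×ˢ Finset.range h).image φ, d.choose j := (Finset.sum_image hinj).symm
      _ ≤ ∑ j ∈ Finset.range (d + 1), d.choose j := by
          refine Finset.sum_le_sum_of_subset fun j hj => ?_
          obtain ⟨x, hx, rfl⟩ := Finset.mem_image.1 hj
          obtain ⟨ht, hi⟩ := Finset.mem_product.1 hx
          obtain ⟨hxD, hf⟩ := hEm x.1 ht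
          have := hDd x.1 hxD
          simp only [Finset.mem_range] at hi ⊢
          simp only [φ]
          split_ifs <;> omega
      _ = 2 ^ d := Nat.sum_range_choose d
  rw [← Finset.sum_filter_add_sum_filter_not D near, Nat.mul_add]
  exact Nat.add_le_add (Nat.mul_le_mul_left _ hnear) hfar

/-! ### From level bounds to bounds for subcubes. -/

/-- Bounds on the level sizes `N t` of a subset of a `d`-dimensional subcube whose levels lie in one
residue class, and which takes up at most `5 / 6` of each level other than the outermost four. -/
structure LevelBound (m d : ℕ) (N : ℕ → ℕ) : Prop where
  le_choose : ∀ t, N t ≤ d.choose t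
  six_mul_le : ∀ t, 2 ≤ t → t + 2 ≤ d → 6 * N t ≤ 5 * d.choose t
  mod_eq : ∀ t t', N t ≠ 0 → N t' ≠ 0 → t % m = t' % m

/-- Modulo `3` only the levels `{0, 3}`, `{1, 4}` or `{2}` can occur together, giving at most `1 +
4`, `4 + 1` and `5/6 · 6` points. -/
theorem LevelBound.sum_le_five {N : ℕ → ℕ} (h : LevelBound 3 4 N) :
    ∑ t ∈ Finset.range 5, N t ≤ 5 := by
  have h0 := h.le_choose 0
  have h1 := h.le_choose 1
  have h2 := h.six_mul_le 2 le_rfl le_rfl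
  have h3 := h.le_choose 3
  have h4 := h.le_choose 4
  have e01 := h.mod_eq 0 1
  have e02 := h.mod_eq 0 2
  have e12 := h.mod_eq 1 2
  have e13 := h.mod_eq 1 3
  have e23 := h.mod_eq 2 3
  have e24 := h.mod_eq 2 4
  have e34 := h.mod_eq 3 4
  have e04 := h.mod_eq 0 4
  norm_num [Nat.choose] at h0 h1 h2 h3 h4 e01 e02 e12 e13 e23 e24 e34 e04
  simp only [Finset.sum_range_succ, Finset.sum_range_zero]
  omega

theorem LevelBound.sum_lt_choose {d : ℕ} {N : ℕ → ℕ} (hd : 5 ≤ d)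
    (h : LevelBound (2 * (20 * (Nat.sqrt d + 1))) d N) :
    ∑ t ∈ Finset.range (d + 1), N t < d.choose (d / 2) := by
  set s := Nat.sqrt d + 1 with hs
  set M := d.choose (d / 2) with hM
  have hd2 : d * (d - 1) ≤ 2 * M := by
    have h1 : d.choose 2 ≤ M := Nat.choose_le_middle 2 d
    rw [Nat.choose_two_right] at h1
    have := Nat.div_mul_cancel (Nat.even_mul_pred_self d).two_dvd
    omega
  have hdM : d < M := by
    have : d * 4 ≤ d * (d - 1) := Nat.mul_le_mul_left _ (by omega)
    omega
  have houter : ∀ t, t ≤ d → ¬ (2 ≤ t ∧ t + 2 ≤ d) → d.choose t ≤ d := by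
    intro t ht hcon
    have : t = 0 ∨ t = 1 ∨ t = d - 1 ∨ t = d := by omega
    rcases this with rfl | rfl | rfl | rfl
    · simp; omega
    · simp
    · rw [Nat.choose_symm (by omega)]; simp
    · simp; omega
  have hbound : ∀ t, t ≤ d → 6 * N t ≤ 5 * d.choose t + if 2 ≤ t ∧ t + 2 ≤ d then 0 else d := by
    intro t ht
    split_ifs with hc
    · exact h.six_mul_le t hc.1 hc.2
    · have := houter t ht hc
      have := h.le_choose t
      omega
  set D := (Finset.range (d + 1)).filter fun t => N t ≠ 0 with hD
  have hsumD : ∑ t ∈ Finset.range (d + 1), N t = ∑ t ∈ D, N t :=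
    (Finset.sum_filter_ne_zero _).symm
  have hDm : ∀ t ∈ D, t ≤ d ∧ N t ≠ 0 := by
    intro t ht
    obtain ⟨h1, h2⟩ := Finset.mem_filter.1 ht
    exact ⟨by simpa [Nat.lt_succ_iff] using h1, h2⟩
  rw [hsumD]
  rcases D.eq_empty_or_nonempty with hempty | ⟨t₀, ht₀⟩
  · rw [hempty, Finset.sum_empty]; omega
  -- If `d` is below the modulus, only one level is occupied.
  by_cases hsmall : d < 2 * (20 * s)
  · have hone : D = {t₀} := by
      refine Finset.eq_singleton_iff_unique_mem.2 ⟨ht₀, fun t ht => ?_⟩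
      have := h.mod_eq t t₀ (hDm t ht).2 (hDm t₀ ht₀).2
      rwa [Nat.mod_eq_of_lt ((hDm t ht).1.trans_lt hsmall),
        Nat.mod_eq_of_lt ((hDm t₀ ht₀).1.trans_lt hsmall)] at this
    rw [hone, Finset.sum_singleton]
    by_cases hc : 2 ≤ t₀ ∧ t₀ + 2 ≤ d
    · have h1 := h.six_mul_le t₀ hc.1 hc.2
      have h2 : d.choose t₀ ≤ M := Nat.choose_le_middle t₀ d
      omega
    · have h1 := houter t₀ (hDm t₀ ht₀).1 hc
      have h2 := h.le_choose t₀
      omega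
  · have hspos : 0 < s := Nat.succ_pos _
    have hsum := mul_sum_choose_le (d := d) (h := 20 * s) (a := t₀ % (2 * (20 * s))) D
      (fun t ht => (hDm t ht).1) (fun t ht => h.mod_eq t t₀ (hDm t ht).2 (hDm t₀ ht₀).2)
    have hpow := two_pow_le_sqrt_mul_choose d (by omega)
    -- Since `2 ^ d ≤ 2 * s * M`, taking `h = 20 * s` makes the excess over `M` at most `M / 10`.
    have h10 : 10 * ∑ t ∈ D, d.choose t ≤ 11 * M := by
      refine le_of_mul_le_mul_left (a := 2 * s) ?_ (by omega)
      nlinarith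
    have hextra : ∑ t ∈ D, (if 2 ≤ t ∧ t + 2 ≤ d then 0 else d) ≤ 4 * d := by
      rw [Finset.sum_ite, Finset.sum_const_zero, zero_add, Finset.sum_const, smul_eq_mul]
      refine Nat.mul_le_mul_right _ ?_
      refine (Finset.card_le_card (t := {0, 1, d - 1, d}) ?_).trans Finset.card_le_four
      intro t ht
      obtain ⟨h1, h2⟩ := Finset.mem_filter.1 ht
      have := (hDm t h1).1
      simp only [Finset.mem_insert, Finset.mem_singleton]
      omega
    have htot : 6 * ∑ t ∈ D, N t ≤ 5 * ∑ t ∈ D, d.choose t + 4 * d := by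
      rw [Finset.mul_sum, Finset.mul_sum]
      refine (Finset.sum_le_sum fun t ht => hbound t (hDm t ht).1).trans ?_
      rw [Finset.sum_add_distrib]
      omega
    -- Here `d ≥ 40`, so `39 * d ≤ 2 * M`, and the outer contribution `4 * d` is less than the spare
    -- `M / 2`.
    have : d * 39 ≤ d * (d - 1) := Nat.mul_le_mul_left _ (by omega)
    omega

/-! ### Subcubes and the family of independent sets. -/

/-- The set of coordinates at which a point of the cube is `1`. -/
def ones {n : ℕ} (x : Cube n) : Finset (Fin n) := Finset.univ.filter fun i => x i = true

theorem mem_ones {n : ℕ} {x : Cube n} {i : Fin n} : i ∈ ones x ↔ x i = true := by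
  unfold ones
  rw [Finset.mem_filter]
  exact and_iff_right (Finset.mem_univ i)

theorem ones_decide_mem {n : ℕ} (A : Finset (Fin n)) : ones (fun i => decide (i ∈ A)) = A := by
  ext i; rw [mem_ones, decide_eq_true_eq]

/-- The point with coordinates `c` on `S` whose ones outside `S` form the image of `X`. -/
def subcubePoint {n d : ℕ} (S : Finset (Fin n)) (c : Cube n) (e : Fin d ↪ Fin n)
    (X : Finset (Fin d)) : Cube n :=
  fun i => if i ∈ S then c i else decide (i ∈ X.map e)

theorem ones_subcubePoint {n d : ℕ} (S : Finset (Fin n)) (c : Cube n) (e : Fin d ↪ Fin n)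
    (he : ∀ j, e j ∉ S) (X : Finset (Fin d)) :
    ones (subcubePoint S c e X) = (S.filter fun i => c i = true) ∪ X.map e := by
  ext i
  simp only [mem_ones, subcubePoint, Finset.mem_filter, Finset.mem_union]
  by_cases hi : i ∈ S
  · have : i ∉ X.map e := by
      rintro h
      obtain ⟨j, -, rfl⟩ := Finset.mem_map.1 h
      exact he j hi
    simp only [hi, this, if_true, true_and, or_false]
  · simp only [hi, if_false, false_and, false_or, decide_eq_true_eq]

theorem disjoint_filter_map {n d : ℕ} (S : Finset (Fin n)) (c : Cube n) (e : Fin d ↪ Fin n)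
    (he : ∀ j, e j ∉ S) (X : Finset (Fin d)) :
    Disjoint (S.filter fun i => c i = true) (X.map e) := by
  refine Finset.disjoint_left.2 fun i hi h => ?_
  obtain ⟨j, -, rfl⟩ := Finset.mem_map.1 h
  exact he j (Finset.mem_filter.1 hi).1

/-- A `d`-dimensional subcube is parametrized by the subsets of `Fin d`. -/
theorem IsSubcube.exists_subcubePoint {n d : ℕ} {V : Finset (Cube n)} (hV : IsSubcube d V) :
    ∃ (S : Finset (Fin n)) (c : Cube n) (e : Fin d ↪ Fin n), (∀ j, e j ∉ S) ∧
      Function.Injective (subcubePoint S c e) ∧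
      V = Finset.univ.image (subcubePoint S c e) := by
  obtain ⟨S, c, hS, rfl⟩ := hV
  have hcard : Sᶜ.card = d := by rw [Finset.card_compl, Fintype.card_fin]; omega
  let e : Fin d ↪ Fin n := (Sᶜ.orderEmbOfFin hcard).toEmbedding
  have he : ∀ j, e j ∉ S := fun j => Finset.mem_compl.1 (Finset.orderEmbOfFin_mem _ hcard j)
  refine ⟨S, c, e, he, ?_, ?_⟩
  · intro X Y h
    have h' := congrArg ones h
    rw [ones_subcubePoint S c e he, ones_subcubePoint S c e he] at h'
    have hXY : X.map e = Y.map e := by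
      rw [← Finset.union_sdiff_cancel_left (disjoint_filter_map S c e he X), h',
        Finset.union_sdiff_cancel_left (disjoint_filter_map S c e he Y)]
    exact Finset.map_injective e hXY
  · ext x
    simp only [Finset.mem_filter, Finset.mem_univ, true_and, Finset.mem_image]
    constructor
    · intro hx
      refine ⟨Finset.univ.filter fun j => x (e j) = true, ?_⟩
      funext i
      simp only [subcubePoint]
      split_ifs with hi
      · exact (hx i hi).symm
      · obtain ⟨j, rfl⟩ : ∃ j, e j = i := by
          have : i ∈ Set.range (Sᶜ.orderEmbOfFin hcard) := by
            rw [Finset.range_orderEmbOfFin]; simpa using hi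
          exact this
        simp
    · rintro ⟨X, rfl⟩ i hi
      simp [subcubePoint, hi]

open Classical in
/-- The points of weight `w ≡ a` modulo `m` whose ones select linearly independent vectors among
the `v w i`. -/
noncomputable def independentFamily {n : ℕ} (v : (w : ℕ) → Fin n → Fin w → ZMod 2) (m a : ℕ) :
    Finset (Cube n) :=
  Finset.univ.filter fun x => LinearIndepOn (ZMod 2) (v (ones x).card) (ones x : Set (Fin n)) ∧
    (ones x).card % m = a

open Classical in
theorem levelBound_independentFamily {n m a d : ℕ} (v : (w : ℕ) → Fin n → Fin w → ZMod 2)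
    {V : Finset (Cube n)} (hV : IsSubcube d V) :
    ∃ N : ℕ → ℕ, LevelBound m d N ∧
      (independentFamily v m a ∩ V).card = ∑ t ∈ Finset.range (d + 1), N t := by
  obtain ⟨S, c, e, he, hinj, rfl⟩ := hV.exists_subcubePoint
  set B := S.filter fun i => c i = true with hB
  have hcard : ∀ X, (ones (subcubePoint S c e X)).card = B.card + X.card := by
    intro X
    rw [ones_subcubePoint S c e he, Finset.card_union_of_disjoint (disjoint_filter_map S c e he X),
      Finset.card_map]
  let p : Finset (Fin d) → Prop := fun X => subcubePoint S c e X ∈ independentFamily v m a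
  refine ⟨fun t => ((Finset.powersetCard t Finset.univ).filter p).card, ⟨?_, ?_, ?_⟩, ?_⟩
  · intro t
    exact (Finset.card_filter_le _ _).trans (by simp)
  · intro t ht htd
    have := six_mul_card_le_of_forall_exists_pair p ht (by simpa using htd) ?_
    · simpa using this
    intro Y Z hY hZ hYZ
    have hBY : Disjoint (B ∪ Y.map e) (Z.map e) :=
      Finset.disjoint_union_left.2
        ⟨disjoint_filter_map S c e he Z, (Finset.disjoint_map e).2 hYZ⟩
    -- All points on level `t` of the subcube have weight `B.card + t`, so they share one vector
    -- assignment; `B` and the image of `Y` supply all but two of the ones.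
    obtain ⟨q, hq, hqn⟩ := exists_pair_not_linearIndepOn (v (B.card + t)) (B ∪ Y.map e) (Z.map e)
      (by
        rw [Finset.card_union_of_disjoint (disjoint_filter_map S c e he Y), Finset.card_map,
          Module.finrank_fin_fun, ← hB]
        omega)
      (by rw [Finset.card_map, hZ]) hBY
    obtain ⟨hqZ, hq2⟩ := Finset.mem_powersetCard.1 hq
    obtain ⟨q', hq'Z, rfl⟩ := Finset.subset_map_iff.1 hqZ
    rw [Finset.card_map] at hq2
    refine ⟨q', Finset.mem_powersetCard.2 ⟨hq'Z, hq2⟩, fun hp => hqn ?_⟩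
    have h1 := (Finset.mem_filter.1 hp).2.1
    have hc : (Y ∪ q').card = t := by
      rw [Finset.card_union_of_disjoint (hYZ.mono_right hq'Z)]; omega
    rw [hcard, hc, ones_subcubePoint S c e he, Finset.map_union, ← Finset.union_assoc] at h1
    exact h1
  · have hmod : ∀ t, ((Finset.powersetCard t Finset.univ).filter p).card ≠ 0 →
        (B.card + t) % m = a := by
      intro t ht
      obtain ⟨X, hX⟩ := Finset.card_ne_zero.1 ht
      obtain ⟨hX1, hX2⟩ := Finset.mem_filter.1 hX
      have := (Finset.mem_filter.1 hX2).2.2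
      rwa [hcard, (Finset.mem_powersetCard.1 hX1).2] at this
    intro t t' ht ht'
    exact Nat.ModEq.add_left_cancel' B.card ((hmod t ht).trans (hmod t' ht').symm)
  · have h1 : independentFamily v m a ∩ Finset.univ.image (subcubePoint S c e) =
        (Finset.univ.filter p).image (subcubePoint S c e) := by
      ext x
      simp only [Finset.mem_inter, Finset.mem_image, Finset.mem_univ, true_and,
        Finset.mem_filter, p]
      constructor
      · rintro ⟨hx, X, rfl⟩; exact ⟨X, hx, rfl⟩
      · rintro ⟨X, hx, rfl⟩; exact ⟨hx, X, rfl⟩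
    rw [h1, Finset.card_image_of_injective _ hinj,
      Finset.card_eq_sum_card_fiberwise (f := Finset.card) (t := Finset.range (d + 1))]
    · refine Finset.sum_congr rfl fun t _ => ?_
      congr 1
      ext X
      simp [Finset.mem_powersetCard, and_comm]
    · intro X _
      have := X.card_le_univ
      simp only [Fintype.card_fin] at this
      simp only [Finset.coe_range, Set.mem_Iio]
      omega

open Classical in
theorem exists_density_independentFamily_ge (n : ℕ) {m : ℕ} (hm : 0 < m) :
    ∃ (v : (w : ℕ) → Fin n → Fin w → ZMod 2) (a : ℕ),
      (∏' k : ℕ, factor k) / m ≤ density (independentFamily v m a) := by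
  choose v hv using exists_card_linearIndepOn_ge n
  set P := ∏' k : ℕ, factor k with hP
  let G : Finset (Cube n) := Finset.univ.filter fun x =>
    LinearIndepOn (ZMod 2) (v (ones x).card) (ones x : Set (Fin n))
  -- Before the weights are restricted, the bound is summed over the weight levels.
  have hG : 2 ^ n * P ≤ (G.card : ℝ) := by
    rw [Finset.card_eq_sum_card_fiberwise (f := fun x => (ones x).card)
      (t := Finset.range (n + 1))]
    · have h2 : (2 : ℝ) ^ n = ∑ w ∈ Finset.range (n + 1), (n.choose w : ℝ) := by
        exact_mod_cast (Nat.sum_range_choose n).symm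
      rw [h2, Finset.sum_mul]
      push_cast
      refine Finset.sum_le_sum fun w _ => (hv w).trans ?_
      rw [Nat.cast_le]
      refine Finset.card_le_card_of_injOn (fun A i => decide (i ∈ A)) ?_ ?_
      · intro A hA
        obtain ⟨hA1, hA2⟩ := Finset.mem_filter.1 (Finset.mem_coe.1 hA)
        obtain ⟨-, rfl⟩ := Finset.mem_powersetCard.1 hA1
        have h1 : (fun i => decide (i ∈ A) : Cube n) ∈ G :=
          Finset.mem_filter.2 ⟨Finset.mem_univ _, by rw [ones_decide_mem]; exact hA2⟩
        exact Finset.mem_filter.2 ⟨h1, by rw [ones_decide_mem]⟩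
      · intro A _ A' _ h
        have := congrArg ones h
        simpa only [ones_decide_mem] using this
    · intro x _
      have := (ones x).card_le_univ
      simp only [Fintype.card_fin] at this
      simp only [Finset.coe_range, Set.mem_Iio]
      omega
  -- Pigeonhole over the `m` residue classes of weights.
  obtain ⟨a, -, ha⟩ := Finset.exists_le_card_fiber_of_nsmul_le_card_of_maps_to
    (s := G) (t := Finset.range m) (f := fun x => (ones x).card % m) (b := 2 ^ n * P / m)
    (fun x _ => Finset.mem_range.2 (Nat.mod_lt _ hm)) ⟨0, Finset.mem_range.2 hm⟩ (by
      rw [Finset.card_range, nsmul_eq_mul, mul_div_cancel₀ _ (by positivity)]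
      exact hG)
  refine ⟨v, a, ?_⟩
  have hfib : G.filter (fun x => (ones x).card % m = a) = independentFamily v m a := by
    rw [Finset.filter_filter]; rfl
  rw [hfib] at ha
  unfold density
  rw [le_div_iff₀ (by positivity)]
  calc P / m * 2 ^ n = 2 ^ n * P / m := by ring
    _ ≤ _ := ha

/-! ### The three assertions. -/

theorem exists_density_ge_forall_subcube_levelBound (n : ℕ) {m : ℕ} (hm : 0 < m) :
    ∃ F : Finset (Cube n), (∏' k : ℕ, factor k) / m ≤ density F ∧
      ∀ (d : ℕ) (V : Finset (Cube n)), IsSubcube d V → ∃ N : ℕ → ℕ, LevelBound m d N ∧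
        (F ∩ V).card = ∑ t ∈ Finset.range (d + 1), N t := by
  obtain ⟨v, a, h⟩ := exists_density_independentFamily_ge n hm
  exact ⟨_, h, fun d V hV => levelBound_independentFamily v hV⟩

/-- A set of density at least `L` has a subset whose density is `L` up to `2 ^ (-n)`. -/
theorem exists_subset_density_near {n : ℕ} (F : Finset (Cube n)) {L : ℝ} (hL : 0 ≤ L)
    (hF : L ≤ density F) :
    ∃ F' ⊆ F, L - (1 / 2 : ℝ) ^ n ≤ density F' ∧ density F' ≤ L := by
  have h2 : (0 : ℝ) < 2 ^ n := by positivity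
  have hfl : ⌊L * 2 ^ n⌋₊ ≤ F.card := by
    refine Nat.floor_le_of_le ?_
    rwa [density, le_div_iff₀ h2] at hF
  obtain ⟨F', hF', hc⟩ := Finset.exists_subset_card_eq hfl
  refine ⟨F', hF', ?_, ?_⟩
  · rw [density, hc, le_div_iff₀ h2, sub_mul, ← mul_pow]
    have := Nat.lt_floor_add_one (L * 2 ^ n)
    norm_num
    linarith
  · rw [density, hc, div_le_iff₀ h2]
    exact Nat.floor_le (by positivity)

/-- The construction may be denser than the stated limit; passing to subsets keeps the bound five
and makes the densities converge to it. -/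
theorem exists_subcube_four_card_le_five :
    ∃ F : (n : ℕ) → Finset (Cube n),
      (∀ n : ℕ, ∀ V : Finset (Cube n), IsSubcube 4 V → (F n ∩ V).card ≤ 5) ∧
      Tendsto (fun n : ℕ => density (F n)) atTop (𝓝 ((1 / 3 : ℝ) * ∏' k : ℕ, factor k)) := by
  have hL := tprod_factor_pos
  have hex : ∀ n : ℕ, ∃ F : Finset (Cube n),
      (∀ V : Finset (Cube n), IsSubcube 4 V → (F ∩ V).card ≤ 5) ∧
      (1 / 3 : ℝ) * ∏' k : ℕ, factor k - (1 / 2 : ℝ) ^ n ≤ density F ∧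
      density F ≤ (1 / 3 : ℝ) * ∏' k : ℕ, factor k := by
    intro n
    obtain ⟨F, hd, hF⟩ := exists_density_ge_forall_subcube_levelBound n (m := 3) (by norm_num)
    obtain ⟨F', hsub, h1, h2⟩ := exists_subset_density_near F
      (L := (1 / 3 : ℝ) * ∏' k : ℕ, factor k) (by positivity)
      (le_trans (le_of_eq (by push_cast; ring)) hd)
    refine ⟨F', fun V hV => ?_, h1, h2⟩
    obtain ⟨N, hN, hcard⟩ := hF 4 V hV
    exact (Finset.card_le_card (Finset.inter_subset_inter_right hsub)).trans
      (hcard.trans_le hN.sum_le_five)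
  choose F hF h1 h2 using hex
  refine ⟨F, hF, tendsto_of_tendsto_of_tendsto_of_le_of_le ?_ tendsto_const_nhds h1 h2⟩
  have := (tendsto_pow_atTop_nhds_zero_of_lt_one (r := (1 / 2 : ℝ)) (by norm_num)
    (by norm_num)).const_sub ((1 / 3 : ℝ) * ∏' k : ℕ, factor k)
  simpa using this

theorem exists_subcube_card_lt_choose :
    ∃ c : ℝ, 0 < c ∧ ∀ d : ℕ, 5 ≤ d → ∀ n : ℕ, ∃ F : Finset (Cube n),
      (∀ V : Finset (Cube n), IsSubcube d V → (F ∩ V).card < d.choose (d / 2)) ∧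
      c / Real.sqrt d ≤ density F := by
  have hL := tprod_factor_pos
  -- The modulus `40 * (Nat.sqrt d + 1)` is at most `80 * √d`.
  refine ⟨(∏' k : ℕ, factor k) / 80, by positivity, fun d hd n => ?_⟩
  obtain ⟨F, hdens, hF⟩ := exists_density_ge_forall_subcube_levelBound n
    (m := 2 * (20 * (Nat.sqrt d + 1))) (by positivity)
  refine ⟨F, fun V hV => ?_, le_trans ?_ hdens⟩
  · obtain ⟨N, hN, hcard⟩ := hF d V hV
    exact hcard.trans_lt (hN.sum_lt_choose hd)
  · rw [div_div]
    refine div_le_div_of_nonneg_left hL.le (by positivity) ?_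
    have h1 : (Nat.sqrt d : ℝ) ≤ Real.sqrt d := Real.nat_sqrt_le_real_sqrt
    have h2 : (1 : ℝ) ≤ Real.sqrt d := Real.one_le_sqrt.2 (by exact_mod_cast (by omega : 1 ≤ d))
    push_cast
    linarith

theorem not_johnsonTalbotProperty_of_forall_exists {d : ℕ} {δ : ℝ} (hδ : 0 < δ)
    (h : ∀ n₀ : ℕ, ∃ n, n₀ ≤ n ∧ ∃ F : Finset (Cube n), δ ≤ density F ∧
      ∀ V : Finset (Cube n), IsSubcube d V → (F ∩ V).card < d.choose (d / 2)) :
    ¬ JohnsonTalbotProperty d := by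
  intro hJT
  obtain ⟨n₀, hn₀⟩ := hJT δ hδ
  obtain ⟨n, hn, F, hF, hV⟩ := h n₀
  obtain ⟨V, hVd, hc⟩ := hn₀ n hn F hF
  exact absurd (hV V hVd) (not_lt.2 hc)

theorem theorem5 :
    -- the infinite product converges, and a third of it is about 0.0963
    (Multipliable factor ∧ |(1 / 3 : ℝ) * (∏' k : ℕ, factor k) - 0.0963| < 0.0001) ∧
    -- 4-dimensional subcubes
    (∃ F : (n : ℕ) → Finset (Cube n),
      (∀ n : ℕ, ∀ V : Finset (Cube n), IsSubcube 4 V → (F n ∩ V).card ≤ 5) ∧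
      Tendsto (fun n : ℕ => density (F n)) atTop (𝓝 ((1 / 3 : ℝ) * ∏' k : ℕ, factor k))) ∧
    -- d-dimensional subcubes for d at least 5, with an absolute constant c
    (∃ c : ℝ, 0 < c ∧ ∀ d : ℕ, 5 ≤ d → ∀ n : ℕ, ∃ F : Finset (Cube n),
      (∀ V : Finset (Cube n), IsSubcube d V → (F ∩ V).card < d.choose (d / 2)) ∧
      c / Real.sqrt d ≤ density F) ∧
    -- the question of Johnson and Talbot has a negative answer for every d at least 4
    (∀ d : ℕ, 4 ≤ d → ¬ JohnsonTalbotProperty d) := by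
  refine ⟨⟨multipliable_factor, abs_tprod_factor_sub_lt⟩, exists_subcube_four_card_le_five,
    exists_subcube_card_lt_choose, fun d hd => ?_⟩
  have hL := tprod_factor_pos
  rcases hd.eq_or_lt with rfl | hd
  · obtain ⟨F, hF, hlim⟩ := exists_subcube_four_card_le_five
    -- Half the limiting density is eventually exceeded.
    refine not_johnsonTalbotProperty_of_forall_exists
      (δ := (1 / 6 : ℝ) * ∏' k : ℕ, factor k) (by positivity) fun n₀ => ?_
    have hev := hlim.eventually_const_le
      (by linarith : (1 / 6 : ℝ) * ∏' k : ℕ, factor k < (1 / 3 : ℝ) * ∏' k : ℕ, factor k)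
    obtain ⟨n, hn, hn'⟩ := ((eventually_ge_atTop n₀).and hev).exists
    refine ⟨n, hn, F n, hn', fun V hV => (Nat.lt_succ_of_le (hF n V hV)).trans_le ?_⟩
    decide
  · obtain ⟨c, hc, h⟩ := exists_subcube_card_lt_choose
    have hd0 : (0 : ℝ) < d := by exact_mod_cast (by omega : 0 < d)
    refine not_johnsonTalbotProperty_of_forall_exists (δ := c / Real.sqrt d)
      (div_pos hc (Real.sqrt_pos.2 hd0)) fun n₀ => ?_
    obtain ⟨F, hF, hdens⟩ := h d hd n₀
    exact ⟨n₀, le_rfl, F, hdens, hF⟩
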